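/- A triply periodic network $N$ of degree $d\ge 3$ is a connected simple graph, all of whose vertices have degree $d$, immersed in $\mathbb{R}^3$ with straight edges of positive length (immersed means that the star of every vertex, i.e. the union of the edges at it, is embedded), which is invariant under the translations in a lattice $\Lambda\subset\mathbb{R}^3$ of rank $3$ and whose quotient $N/\Lambda$ is a finite graph, possibly with loops and multiple edges. Let $L$ be the total length of the edges of $N/\Lambda$ and let $V$ be the volume of a fundamental domain $\mathbb{R}^3/\Lambda$. The dipole graph $D_5$ consists of two vertices joined by five edges, without loops. **Theorem.** Let $N$ be a triply periodic network whose quotient graph $N/\Lambda$ is isomorphic to $D_5$. Then $$\frac{L^3}{V}\ \ge\ \frac{405}{8}=50.625.$$ If equality holds, then for each vertex of $N$ its five neighbours form the vertices of a right square pyramid with height $L/3$, that is, a pyramid over a non-degenerate square whose apex lies perpendicularly above the centre of the square, at distance $L/3$ from it. -/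

import Mathlib

/-- An `n`-periodic network of degree `d`: a connected simple graph with vertex type `V`, with
straight edges of positive length immersed in Euclidean `n`-space (the star of every vertex is
embedded), all of whose vertices have degree `d`, which is invariant under the translations in a
lattice `Λ` of rank `n`, with finite quotient by `Λ`.

The lattice acts on the graph by automorphisms, and the placement `pos` of the vertices is
equivariant. As the network is only immersed, `pos` need not be injective, and edges may cross. -/
structure PeriodicNetwork (n d : ℕ) (V : Type*) where
  two_le_dim : 2 ≤ n
  three_le_degree : 3 ≤ d
  /-- The underlying abstract graph. -/
  graph : SimpleGraph V
  connected : graph.Connected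
  degree_eq : ∀ v, (graph.neighborSet v).encard = d
  /-- The positions of the vertices. -/
  pos : V → EuclideanSpace ℝ (Fin n)
  /-- Edges have positive length. -/
  pos_ne : ∀ u v, graph.Adj u v → pos u ≠ pos v
  /-- Stars are embedded: two edges from `v` have only the point `pos v` in common. -/
  star_embedded : ∀ v u w, graph.Adj v u → graph.Adj v w → u ≠ w →
    segment ℝ (pos v) (pos u) ∩ segment ℝ (pos v) (pos w) = {pos v}
  /-- The lattice of periods. -/
  Λ : Submodule ℤ (EuclideanSpace ℝ (Fin n))
  [discrete : DiscreteTopology Λ]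
  [isZLattice : IsZLattice ℝ Λ]
  [action : AddAction Λ V]
  adj_vadd : ∀ (g : Λ) (u v : V), graph.Adj u v → graph.Adj (g +ᵥ u) (g +ᵥ v)
  pos_vadd : ∀ (g : Λ) (v : V), pos (g +ᵥ v) = (g : EuclideanSpace ℝ (Fin n)) + pos v
  /-- The quotient has finitely many vertices. -/
  finite_vertices : Finite (AddAction.orbitRel.Quotient Λ V)
  /-- The quotient has finitely many edges: finitely many edges of the network represent all edges
  up to translation. -/
  finite_edges : ∃ S : Set (Sym2 V), S.Finite ∧
    ∀ e ∈ graph.edgeSet, ∃ g : Λ, Sym2.map (g +ᵥ ·) e ∈ S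

namespace PeriodicNetwork

attribute [instance] discrete isZLattice action

variable {n d : ℕ} {V : Type*} (N : PeriodicNetwork n d V)

/-- Two edges are equivalent if they differ by a translation in the lattice. -/
def edgeSetoid : Setoid N.graph.edgeSet where
  r e f := ∃ g : N.Λ, Sym2.map (g +ᵥ ·) (e : Sym2 V) = f
  iseqv :=
    { refl := fun e => ⟨0, by simp⟩
      symm := by
        rintro e f ⟨g, h⟩
        refine ⟨-g, ?_⟩
        rw [← h, Sym2.map_map]
        have : ((fun v : V => -g +ᵥ v) ∘ fun v : V => g +ᵥ v) = id := by
          funext v; simp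
        rw [this, Sym2.map_id, id]
      trans := by
        rintro e f k ⟨g, h⟩ ⟨g', h'⟩
        refine ⟨g' + g, ?_⟩
        rw [← h', ← h, Sym2.map_map]
        congr 1
        funext v
        simp [add_vadd] }

/-- The vertices of the quotient network. -/
abbrev QuotientVertex : Type _ := AddAction.orbitRel.Quotient N.Λ V

/-- The edges of the quotient network. -/
abbrev QuotientEdge : Type _ := Quotient N.edgeSetoid

/-- The class of a vertex of the network in the quotient. -/
def toQuotientVertex (v : V) : N.QuotientVertex := Quotient.mk _ v

/-- The class of an edge of the network in the quotient. -/
def toQuotientEdge (e : N.graph.edgeSet) : N.QuotientEdge := Quotient.mk _ e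

lemma toQuotientVertex_vadd (g : N.Λ) (v : V) :
    N.toQuotientVertex (g +ᵥ v) = N.toQuotientVertex v :=
  Quotient.sound ⟨g, rfl⟩

/-- The quotient graph of the network by its lattice, a multigraph which may have loops and
multiple edges. The class of an edge `uv` links the classes of `u` and `v`. -/
def quotientGraph : Graph N.QuotientVertex N.QuotientEdge where
  vertexSet := Set.univ
  IsLink e x y := ∃ (u v : V) (h : N.graph.Adj u v),
    N.toQuotientEdge ⟨s(u, v), h⟩ = e ∧ N.toQuotientVertex u = x ∧ N.toQuotientVertex v = y
  isLink_symm := by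
    rintro e -
    constructor
    rintro x y ⟨u, v, h, rfl, rfl, rfl⟩
    refine ⟨v, u, h.symm, ?_, rfl, rfl⟩
    congr 2
    exact Sym2.eq_swap
  eq_or_eq_of_isLink_of_isLink := by
    rintro e x y z w ⟨u, v, h, he, rfl, rfl⟩ ⟨u', v', h', rfl, rfl, rfl⟩
    obtain ⟨g, hg⟩ := Quotient.exact he
    simp only [Sym2.map_mk, Sym2.eq_iff] at hg
    rcases hg with ⟨h1, -⟩ | ⟨h1, -⟩
    · left; rw [← h1, toQuotientVertex_vadd]
    · right; rw [← h1, toQuotientVertex_vadd]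
  left_mem_of_isLink := fun _ _ _ _ => Set.mem_univ _

/-- The Euclidean length of an edge of the quotient network. -/
noncomputable def edgeLength : N.QuotientEdge → ℝ :=
  Quotient.lift
    (fun e : N.graph.edgeSet =>
      Sym2.lift ⟨fun u v => dist (N.pos u) (N.pos v), fun _ _ => dist_comm _ _⟩ (e : Sym2 V))
    (by
      rintro ⟨e, he⟩ ⟨f, hf⟩ ⟨g, h⟩
      dsimp only at h ⊢
      subst h
      induction e using Sym2.ind with
      | _ u v => simp [N.pos_vadd])

/-- The length `L` of the network: the sum of the lengths of the (finitely many) edges of the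
quotient. -/
noncomputable def length : ℝ := ∑ᶠ e : N.QuotientEdge, N.edgeLength e

/-- The spanned volume `V` of the network: the volume of a fundamental domain of the lattice. -/
noncomputable def spannedVolume : ℝ := ZLattice.covolume N.Λ

/-- The positions of the neighbours of the vertex `v`. -/
def neighbourPositions (v : V) : Set (EuclideanSpace ℝ (Fin n)) :=
  N.pos '' N.graph.neighborSet v

end PeriodicNetwork

/-- Isomorphism of multigraphs: bijections of the vertices and of the edges that preserve
incidence. -/
def MultigraphIso {α β α' β' : Type*} (G : Graph α β) (H : Graph α' β') : Prop :=
  ∃ (f : G.vertexSet ≃ H.vertexSet) (g : G.edgeSet ≃ H.edgeSet),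
    ∀ (e : G.edgeSet) (x y : G.vertexSet), G.IsLink e x y ↔ H.IsLink (g e) (f x) (f y)

/-- The dipole graph `D_k`: two vertices joined by `k` edges, and no loops. -/
def dipoleGraph (k : ℕ) : Graph (Fin 2) (Fin k) := Graph.banana 0 1 Set.univ

/-- `S` is the set of the five vertices of a (right) square pyramid of height `h` in 3-space: a
non-degenerate square with centre `c` and orthogonal half diagonals `u`, `w` of equal length,
together with an apex `c + z` at height `h` perpendicularly above the centre of the square. -/
def IsSquarePyramid (S : Set (EuclideanSpace ℝ (Fin 3))) (h : ℝ) : Prop :=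
  ∃ c u w z : EuclideanSpace ℝ (Fin 3),
    u ≠ 0 ∧ ‖u‖ = ‖w‖ ∧ inner ℝ u w = 0 ∧
    inner ℝ z u = 0 ∧ inner ℝ z w = 0 ∧ ‖z‖ = h ∧ 0 < h ∧
    S = {c + u, c - u, c + w, c - w, c + z}

/-! Fix a vertex. Its five edge vectors `e i`, of lengths l_i, represent the edges of the quotient
once each, so L = ∑ l_i. Their endpoints lie in one translation class, so their differences lie in
Λ, and these span space because the network is connected. Up to sign and division by the covolume v,
the cofactors of the last column of the matrix with rows (`e i`, 1, c_i) are integers k_i, not all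
zero. They form an affine dependency: ∑ k_i = 0 and ∑ k_i `e i` = 0.

Taking c_i = k_i l_i makes the determinant ± v K with K = ∑ k_i² l_i, and makes the last column
orthogonal to the others for the row weights 1/l_i. A weighted Hadamard inequality, which is AM-GM
for the eigenvalues of a Gram matrix, gives 27 v² K ≤ L³ E, where E is the fourth elementary
symmetric polynomial of the lengths (`covolume_sq_le_and_gram`).

Integrality bounds K from below. The points are distinct, so at least three k_i are nonzero, and
three numbers ±1 cannot sum to zero. Hence K is at least a sum of four lengths, or at least 4a + b +
c for three of them. In both cases 6075 E ≤ 64 L³ K, strictly in the second (`esymmFour_le_of_four`,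
`esymmFour_lt_of_three`), and 405 v ≤ 8 L³ follows.

Equality forces the lengths into the ratio 8 : 8 : 8 : 8 : 13 and k into two signs +1, two signs -1
and a zero. It also makes the weighted Gram matrix the identity. All inner products are then known,
and they are those of a square pyramid. -/

/-! ### Weighted Hadamard inequality -/

open Matrix in
/-- A positive semidefinite matrix of size `n` with trace `n` and determinant at least `1` is the
identity. -/
lemma Matrix.PosSemidef.eq_one_of_trace_of_one_le_det {n : Type*} [Fintype n] [DecidableEq n]
    {G : Matrix n n ℝ} (hG : G.PosSemidef) (htr : G.trace = Fintype.card n) (hdet : 1 ≤ G.det) :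
    G = 1 := by
  have hH := hG.isHermitian
  have h0 : ∀ i, 0 ≤ hH.eigenvalues i := hG.eigenvalues_nonneg
  have htr' : ∑ i, (hH.eigenvalues i - 1) = 0 := by
    have := hH.trace_eq_sum_eigenvalues
    simp only [RCLike.ofReal_real_eq_id, id] at this
    rw [Finset.sum_sub_distrib, ← this, htr]; simp
  have hdet' : G.det = ∏ i, hH.eigenvalues i := by
    simpa using hH.det_eq_prod_eigenvalues
  have hpos : ∀ i, 0 < hH.eigenvalues i := by
    intro i
    refine lt_of_le_of_ne (h0 i) fun h => ?_
    rw [Finset.prod_eq_zero (Finset.mem_univ i) h.symm] at hdet'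
    linarith
  have hone : ∀ i, hH.eigenvalues i = 1 := by
    intro i
    by_contra hi
    -- AM-GM through x ≤ exp (x - 1), strict unless x = 1; the exponents sum to zero.
    have hlt : ∏ i, hH.eigenvalues i < ∏ i, Real.exp (hH.eigenvalues i - 1) := by
      refine Finset.prod_lt_prod (fun j _ => hpos j) (fun j _ => ?_) ⟨i, Finset.mem_univ i, ?_⟩
      · linarith [Real.add_one_le_exp (hH.eigenvalues j - 1)]
      · linarith [Real.add_one_lt_exp (sub_ne_zero.mpr hi)]
    rw [← Real.exp_sum, htr', Real.exp_zero] at hlt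
    linarith
  have hsp := hH.spectral_theorem
  have : (diagonal (RCLike.ofReal ∘ hH.eigenvalues) : Matrix n n ℝ) = 1 := by
    rw [← diagonal_one]; congr 1; funext i; simp [hone]
  rw [this, map_one] at hsp
  exact hsp

open Matrix in
/-- A weighted form of Hadamard's inequality, with its case of equality: if the weighted squares
of the entries of `M` sum up to the size of `M`, then a weighted determinant of `M` is at most `1`
in absolute value, and equality forces weighted orthogonality of the rows. -/
lemma Matrix.weighted_hadamard {n : Type*} [Fintype n] [DecidableEq n] (M : Matrix n n ℝ)
    (w β : n → ℝ) (hw : ∀ i, 0 < w i) (hβ : ∀ i, 0 < β i)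
    (htr : ∑ i, ∑ j, w i * β j * M i j ^ 2 = Fintype.card n) :
    M.det ^ 2 * (∏ i, w i) * (∏ i, β i) ≤ 1 ∧
    (M.det ^ 2 * (∏ i, w i) * (∏ i, β i) = 1 →
      ∀ i j, w i * ∑ k, β k * M i k * M j k = if i = j then 1 else 0) := by
  set B : Matrix n n ℝ :=
    diagonal (fun i => √(w i)) * M * diagonal (fun i => √(β i)) with hB
  have hBij : ∀ i j, B i j = √(w i) * M i j * √(β j) := by
    intro i j; simp [hB, Matrix.mul_diagonal, Matrix.diagonal_mul]
  have hdet : (B * Bᴴ).det = M.det ^ 2 * (∏ i, w i) * (∏ i, β i) := by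
    have h1 : (∏ i, √(w i)) ^ 2 = ∏ i, w i := by
      rw [← Finset.prod_pow]
      exact Finset.prod_congr rfl fun i _ => Real.sq_sqrt (hw i).le
    have h2 : (∏ i, √(β i)) ^ 2 = ∏ i, β i := by
      rw [← Finset.prod_pow]
      exact Finset.prod_congr rfl fun i _ => Real.sq_sqrt (hβ i).le
    rw [conjTranspose_eq_transpose_of_trivial, det_mul, det_transpose, hB, det_mul, det_mul,
      det_diagonal, det_diagonal, ← h1, ← h2]
    ring
  have htr' : (B * Bᴴ).trace = Fintype.card n := by
    rw [← htr, trace]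
    refine Finset.sum_congr rfl fun i _ => ?_
    rw [diag_apply, mul_apply]
    refine Finset.sum_congr rfl fun j _ => ?_
    rw [conjTranspose_apply, star_trivial, hBij]
    have h1 := Real.sq_sqrt (hw i).le
    have h2 := Real.sq_sqrt (hβ j).le
    calc _ = √(w i) ^ 2 * √(β j) ^ 2 * M i j ^ 2 := by ring
      _ = _ := by rw [h1, h2]
  have key : 1 ≤ (B * Bᴴ).det → B * Bᴴ = 1 :=
    (posSemidef_self_mul_conjTranspose B).eq_one_of_trace_of_one_le_det htr'
  rw [← hdet]
  refine ⟨?_, fun h i j => ?_⟩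
  · rcases le_total 1 (B * Bᴴ).det with h | h
    · rw [key h]; simp
    · exact h
  · have h1 := congrFun (congrFun (key h.ge) i) j
    rw [mul_apply, one_apply] at h1
    have hwi : 0 < √(w i) := Real.sqrt_pos.mpr (hw i)
    have hwj : 0 < √(w j) := Real.sqrt_pos.mpr (hw j)
    have h2 : √(w i) * √(w j) * ∑ k, β k * M i k * M j k = if i = j then 1 else 0 := by
      rw [← h1, Finset.mul_sum]
      refine Finset.sum_congr rfl fun k _ => ?_
      rw [conjTranspose_apply, star_trivial, hBij, hBij]
      calc _ = √(w i) * √(w j) * (√(β k) ^ 2 * M i k * M j k) := by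
            rw [Real.sq_sqrt (hβ k).le]
        _ = _ := by ring
    by_cases hij : i = j
    · subst hij
      rw [Real.mul_self_sqrt (hw i).le] at h2
      exact h2
    · rw [if_neg hij] at h2 ⊢
      rcases mul_eq_zero.mp h2 with h3 | h3
      · exact absurd h3 (mul_pos hwi hwj).ne'
      · rw [h3, mul_zero]

/-! ### Polynomial inequalities for the edge lengths -/

lemma mul_mul_le_cube_third {x y z : ℝ} (hx : 0 ≤ x) (hy : 0 ≤ y) (hz : 0 ≤ z) :
    27 * (x * y * z) ≤ (x + y + z) ^ 3 := by
  nlinarith [mul_nonneg hx (sq_nonneg (y - z)), mul_nonneg hy (sq_nonneg (x - z)),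
    mul_nonneg hz (sq_nonneg (x - y)), mul_nonneg (add_nonneg (add_nonneg hx hy) hz)
      (add_nonneg (add_nonneg (sq_nonneg (x - y)) (sq_nonneg (y - z))) (sq_nonneg (z - x)))]

/-- The fourth elementary symmetric polynomial in five variables. -/
def esymmFour (a b c d f : ℝ) : ℝ :=
  a * b * c * d + a * b * c * f + a * b * d * f + a * c * d * f + b * c * d * f

/-- Replacing a, b, c, d by their mean s keeps the right side and does not decrease the left. What
remains is a polynomial in s and m with a double zero at 8m = 13s, the extremal ratio of lengths. -/
lemma esymmFour_le_of_four {a b c d m : ℝ} (ha : 0 < a) (hb : 0 < b) (hc : 0 < c) (hd : 0 < d)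
    (hm : 0 < m) :
    6075 * esymmFour a b c d m ≤ 64 * (a + b + c + d + m) ^ 3 * (a + b + c + d) ∧
    (6075 * esymmFour a b c d m = 64 * (a + b + c + d + m) ^ 3 * (a + b + c + d) →
      a = b ∧ c = d ∧ a = c ∧ 8 * m = 13 * a) := by
  set p := (a + b) / 2 with hp
  set q := (c + d) / 2 with hq
  set s := (p + q) / 2 with hs
  have hp0 : 0 < p := by positivity
  have hq0 : 0 < q := by positivity
  have hs0 : 0 < s := by positivity
  have hx : a * b = p ^ 2 - ((a - b) / 2) ^ 2 := by rw [hp]; ring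
  have hy : c * d = q ^ 2 - ((c - d) / 2) ^ 2 := by rw [hq]; ring
  have hz : p * q = s ^ 2 - ((p - q) / 2) ^ 2 := by rw [hs]; ring
  have h1 : a * b * (c * d) ≤ s ^ 4 := by
    have h2 : a * b ≤ p ^ 2 := by rw [hx]; nlinarith [sq_nonneg ((a - b) / 2)]
    have h3 : c * d ≤ q ^ 2 := by rw [hy]; nlinarith [sq_nonneg ((c - d) / 2)]
    have h4 : p * q ≤ s ^ 2 := by rw [hz]; nlinarith [sq_nonneg ((p - q) / 2)]
    calc a * b * (c * d) ≤ p ^ 2 * q ^ 2 := by gcongr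
      _ = (p * q) ^ 2 := by ring
      _ ≤ (s ^ 2) ^ 2 := by gcongr
      _ = s ^ 4 := by ring
  have he : esymmFour a b c d m = a * b * (c * d) + 4 * m * s ^ 3 -
      m * (4 * s * ((p - q) / 2) ^ 2) - m * (2 * q * ((a - b) / 2) ^ 2) -
      m * (2 * p * ((c - d) / 2) ^ 2) := by
    simp only [esymmFour, hs, hp, hq]; ring
  have hL : 64 * (a + b + c + d + m) ^ 3 * (a + b + c + d) =
      6075 * (s ^ 4 + 4 * m * s ^ 3) + (13 * s - 8 * m) ^ 2 * (61 * s + 4 * m) * s := by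
    simp only [hs, hp, hq]; ring
  have t1 : 0 ≤ m * (4 * s * ((p - q) / 2) ^ 2) := by positivity
  have t2 : 0 ≤ m * (2 * q * ((a - b) / 2) ^ 2) := by positivity
  have t3 : 0 ≤ m * (2 * p * ((c - d) / 2) ^ 2) := by positivity
  have t4 : 0 ≤ (13 * s - 8 * m) ^ 2 * (61 * s + 4 * m) * s := by positivity
  rw [hL, he]
  refine ⟨by linarith, fun h => ?_⟩
  have z1 : m * (4 * s * ((p - q) / 2) ^ 2) = 0 := by linarith
  have z2 : m * (2 * q * ((a - b) / 2) ^ 2) = 0 := by linarith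
  have z3 : m * (2 * p * ((c - d) / 2) ^ 2) = 0 := by linarith
  have z4 : (13 * s - 8 * m) ^ 2 * (61 * s + 4 * m) * s = 0 := by linarith
  have y1 : p - q = 0 := by simpa [hm.ne', hs0.ne'] using z1
  have y2 : a - b = 0 := by simpa [hm.ne', hq0.ne'] using z2
  have y3 : c - d = 0 := by simpa [hm.ne', hp0.ne'] using z3
  have y4 : 13 * s - 8 * m = 0 := by
    have : 61 * s + 4 * m ≠ 0 := by positivity
    simpa [hs0.ne', this] using z4
  refine ⟨by linarith, by linarith, by linarith, by linarith⟩

/-- Averaging b, c and d, f reduces to three variables, where AM-GM with suitable weights has room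
to spare: this case is never extremal. -/
lemma esymmFour_lt_of_three {a b c d f : ℝ} (ha : 0 < a) (hb : 0 < b) (hc : 0 < c) (hd : 0 < d)
    (hf : 0 < f) :
    6075 * esymmFour a b c d f < 64 * (a + b + c + d + f) ^ 3 * (4 * a + b + c) := by
  set p := (b + c) / 2 with hp
  set q := (d + f) / 2 with hq
  have hp0 : 0 < p := by positivity
  have hq0 : 0 < q := by positivity
  have hx : b * c ≤ p ^ 2 := by rw [hp]; nlinarith [sq_nonneg (b - c)]
  have hy : d * f ≤ q ^ 2 := by rw [hq]; nlinarith [sq_nonneg (d - f)]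
  have hL : a + b + c + d + f = a + 2 * p + 2 * q := by rw [hp, hq]; ring
  have hK : 4 * a + b + c = 4 * a + 2 * p := by rw [hp]; ring
  have he : esymmFour a b c d f ≤ p ^ 2 * q ^ 2 + 2 * q * a * p ^ 2 + 2 * p * a * q ^ 2 := by
    have : esymmFour a b c d f = b * c * (d * f) + 2 * q * a * (b * c) + 2 * p * a * (d * f) := by
      simp only [esymmFour, hp, hq]; ring
    rw [this]; gcongr
  -- After division by p q (4a + 2p), this bounds the concave 32ap/(p + 2a) by its tangent p + 18a
  -- at p = 6a.
  have hmean : 32 * (p ^ 2 * q ^ 2 + 2 * q * a * p ^ 2 + 2 * p * a * q ^ 2) ≤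
      p * q * (16 * q + p + 18 * a) * (4 * a + 2 * p) := by
    have : p * q * (16 * q + p + 18 * a) * (4 * a + 2 * p) -
      32 * (p ^ 2 * q ^ 2 + 2 * q * a * p ^ 2 + 2 * p * a * q ^ 2) =
      2 * p * q * (p - 6 * a) ^ 2 := by ring
    have h0 : 0 ≤ 2 * p * q * (p - 6 * a) ^ 2 := by positivity
    linarith
  -- The factors are scaled so that their sum is exactly a + 2p + 2q, the total length.
  have hcube := mul_mul_le_cube_third (x := 35 / 18 * p) (y := 10 / 9 * q)
    (z := (16 * q + p + 18 * a) / 18) (by positivity) (by positivity) (by positivity)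
  have hsum : 35 / 18 * p + 10 / 9 * q + (16 * q + p + 18 * a) / 18 = a + 2 * p + 2 * q := by ring
  rw [hsum] at hcube
  have hlt : 6075 * (p * q * (16 * q + p + 18 * a)) < 2048 * (a + 2 * p + 2 * q) ^ 3 := by
    have : 0 < p * q * (16 * q + p + 18 * a) := by positivity
    nlinarith
  have := mul_lt_mul_of_pos_right hlt (show 0 < 4 * a + 2 * p by positivity)
  rw [hL, hK]
  nlinarith

/-! ### Integral dependencies with sum zero -/

/-- Integers `k₀, …, k₄` with sum zero, at least three of which do not vanish: up to a permutation,
either four of them do not vanish, or three do not, one of which is at least two in absolute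
value. -/
lemma exists_perm_of_sum_eq_zero (k : Fin 5 → ℤ) (hsum : ∑ i, k i = 0)
    (hk : ∀ i j, ∃ x, x ≠ i ∧ x ≠ j ∧ k x ≠ 0) :
    ∃ σ : Equiv.Perm (Fin 5),
      (k (σ 0) ≠ 0 ∧ k (σ 1) ≠ 0 ∧ k (σ 2) ≠ 0 ∧ k (σ 3) ≠ 0) ∨
      (2 ≤ |k (σ 0)| ∧ k (σ 1) ≠ 0 ∧ k (σ 2) ≠ 0) := by
  -- The permutation arranges the absolute values in decreasing order.
  set σ := Tuple.sort (fun i => -|k i|)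
  have hmono : ∀ i j, i ≤ j → |k (σ j)| ≤ |k (σ i)| := fun i j hij =>
    neg_le_neg_iff.mp (Tuple.monotone_sort (fun i => -|k i|) hij)
  have hs : k (σ 0) + k (σ 1) + k (σ 2) + k (σ 3) + k (σ 4) = 0 := by
    rw [← Equiv.sum_comp σ, Fin.sum_univ_five] at hsum; exact hsum
  have h01 := hmono 0 1 (by decide)
  have h12 := hmono 1 2 (by decide)
  have h23 := hmono 2 3 (by decide)
  have h34 := hmono 3 4 (by decide)
  have h2 : k (σ 2) ≠ 0 := by
    obtain ⟨x, hx0, hx1, hx⟩ := hk (σ 0) (σ 1)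
    obtain ⟨y, rfl⟩ := σ.surjective x
    have hy : (2 : Fin 5) ≤ y := by
      have a0 : y ≠ 0 := fun h => hx0 (by rw [h])
      have a1 : y ≠ 1 := fun h => hx1 (by rw [h])
      omega
    intro h
    have := hmono 2 y hy
    rw [h, abs_zero] at this
    exact hx (abs_nonpos_iff.mp this)
  refine ⟨σ, ?_⟩
  have a2 : 0 < |k (σ 2)| := abs_pos.mpr h2
  have h1 : k (σ 1) ≠ 0 := abs_pos.mp (by omega)
  have h0 : k (σ 0) ≠ 0 := abs_pos.mp (by omega)
  by_cases h3 : k (σ 3) = 0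
  · right
    refine ⟨?_, h1, h2⟩
    rw [h3, abs_zero] at h34
    have h4 : k (σ 4) = 0 := abs_nonpos_iff.mp h34
    -- Otherwise the three nonzero entries would all be ±1, and their sum would be odd.
    grind
  · exact Or.inl ⟨h0, h1, h2, h3⟩

/-! ### Affine matrix of five points and the covolume -/

/-- The `5 × 5` matrix whose rows consist of the coordinates of five points in `3`-space, a one,
and a further real number. -/
def affineMatrix (e : Fin 5 → EuclideanSpace ℝ (Fin 3)) (c : Fin 5 → ℝ) :
    Matrix (Fin 5) (Fin 5) ℝ :=
  Matrix.of fun i => ![e i 0, e i 1, e i 2, 1, c i]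

/-- A linear relation between the first four columns is an affine function vanishing at all five
points, which `he` excludes. Four independent columns extend to a basis. This makes the integral
dependency nonzero. -/
lemma exists_det_affineMatrix_ne_zero (e : Fin 5 → EuclideanSpace ℝ (Fin 3))
    (he : ∀ α : EuclideanSpace ℝ (Fin 3), (∀ i, inner ℝ α (e i) = inner ℝ α (e 0)) → α = 0) :
    ∃ c, (affineMatrix e c).det ≠ 0 := by
  set v : Fin 4 → Fin 5 → ℝ := ![fun i => e i 0, fun i => e i 1, fun i => e i 2, fun _ => 1] with hv
  have hli : LinearIndependent ℝ v := by
    rw [Fintype.linearIndependent_iff]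
    intro g hg
    rw [Fin.sum_univ_four] at hg
    have hg' : ∀ i, g 0 * e i 0 + g 1 * e i 1 + g 2 * e i 2 + g 3 = 0 := by
      intro i
      simpa [hv] using congrFun hg i
    have hα : (!₂[g 0, g 1, g 2] : EuclideanSpace ℝ (Fin 3)) = 0 := by
      apply he
      intro i
      simp only [PiLp.inner_apply, Fin.sum_univ_three, RCLike.inner_apply, conj_trivial]
      simp
      linarith [hg' i, hg' 0]
    have h0 : g 0 = 0 := by simpa using congrArg (fun x => x 0) hα
    have h1 : g 1 = 0 := by simpa using congrArg (fun x => x 1) hα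
    have h2 : g 2 = 0 := by simpa using congrArg (fun x => x 2) hα
    have h3 : g 3 = 0 := by simpa [h0, h1, h2] using hg' 0
    intro i
    fin_cases i <;> assumption
  obtain ⟨c, hc⟩ : ∃ c, c ∉ Submodule.span ℝ (Set.range v) := by
    by_contra! h
    have htop : Submodule.span ℝ (Set.range v) = ⊤ := Submodule.eq_top_iff'.mpr h
    have := finrank_span_eq_card hli
    rw [htop, finrank_top] at this
    simp at this
  refine ⟨c, ?_⟩
  have hli5 : LinearIndependent ℝ (Fin.snoc v c : Fin 5 → Fin 5 → ℝ) :=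
    linearIndependent_finSnoc.mpr ⟨hli, hc⟩
  have hcol : (affineMatrix e c).col = (Fin.snoc v c : Fin 5 → Fin 5 → ℝ) := by
    funext j i
    fin_cases j <;> rfl
  rw [← hcol, Matrix.linearIndependent_cols_iff_isUnit, Matrix.isUnit_iff_isUnit_det] at hli5
  exact hli5.ne_zero

/-- If the differences of five points belong to a lattice, the `4 × 4` minors of their affine
matrix are integer multiples of the covolume of the lattice. -/
lemma exists_int_abs_det_affineMatrix (Λ : Submodule ℤ (EuclideanSpace ℝ (Fin 3)))
    [DiscreteTopology Λ] [IsZLattice ℝ Λ] (e : Fin 5 → EuclideanSpace ℝ (Fin 3))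
    (he : ∀ i, e i - e 0 ∈ Λ) :
    ∃ k : Fin 5 → ℤ, ∀ c, |(affineMatrix e c).det| = ZLattice.covolume Λ * |∑ i, c i * k i| := by
  have hfin : Module.Finite ℤ Λ := ZLattice.module_finite ℝ Λ
  have hfree : Module.Free ℤ Λ := ZLattice.module_free ℝ Λ
  have hrank : Module.finrank ℤ Λ = 3 := by
    rw [ZLattice.rank ℝ Λ]; simp
  let b : Module.Basis (Fin 3) ℤ Λ := Module.finBasisOfFinrankEq ℤ Λ hrank
  have hcov : ZLattice.covolume Λ = |(Matrix.of fun i j : Fin 3 =>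
      (b i : EuclideanSpace ℝ (Fin 3)) j).det| := by
    rw [ZLattice.covolume_eq_det_mul_measureReal Λ MeasureTheory.volume b
      (EuclideanSpace.basisFun (Fin 3) ℝ).toBasis]
    have : MeasureTheory.volume.real
        (ZSpan.fundamentalDomain (EuclideanSpace.basisFun (Fin 3) ℝ).toBasis) = 1 := by
      rw [MeasureTheory.measureReal_def,
        MeasureTheory.measure_congr (ZSpan.fundamentalDomain_ae_parallelepiped
          (EuclideanSpace.basisFun (Fin 3) ℝ).toBasis MeasureTheory.volume),
        OrthonormalBasis.coe_toBasis, OrthonormalBasis.volume_parallelepiped]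
      simp
    rw [this, mul_one, Module.Basis.det_apply, ← Matrix.det_transpose]
    congr 2
  let F : Fin 5 → Fin 3 → ℤ := fun i => b.repr ⟨_, he i⟩
  have hF : ∀ i, e i = e 0 + ∑ j, (F i j : ℝ) • (b j : EuclideanSpace ℝ (Fin 3)) := by
    intro i
    have h1 := congrArg (Subtype.val) (b.sum_repr ⟨_, he i⟩)
    simp only [Submodule.coe_sum, Submodule.coe_smul] at h1
    rw [← sub_eq_iff_eq_add', ← h1]
    exact Finset.sum_congr rfl fun j _ => (Int.cast_smul_eq_zsmul ℝ _ _).symm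
  let A : Matrix (Fin 5) (Fin 5) ℤ := Matrix.of fun i => ![F i 0, F i 1, F i 2, 1, 0]
  -- Change from lattice to Euclidean coordinates, with origin `e 0`; its determinant is the
  -- covolume up to sign.
  let T : Matrix (Fin 5) (Fin 5) ℝ :=
    !![b 0 |>.1 0, b 0 |>.1 1, b 0 |>.1 2, 0, 0; b 1 |>.1 0, b 1 |>.1 1, b 1 |>.1 2, 0, 0;
      b 2 |>.1 0, b 2 |>.1 1, b 2 |>.1 2, 0, 0; e 0 0, e 0 1, e 0 2, 1, 0; 0, 0, 0, 0, 1]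
  refine ⟨fun i => A.adjugate 4 i, fun c => ?_⟩
  have hT : T.det = (Matrix.of fun i j : Fin 3 => (b i : EuclideanSpace ℝ (Fin 3)) j).det := by
    rw [Matrix.det_fin_three, Matrix.det_succ_column T 4]
    simp only [T, Fin.sum_univ_five]
    simp [Matrix.det_succ_row_zero, Fin.sum_univ_succ, Fin.succAbove]
    ring
  have hmul : affineMatrix e c = ((A.map (Int.castRingHom ℝ)).updateCol 4 c) * T := by
    ext i j
    have := congrArg (fun x => x.ofLp) (hF i)
    rw [Fin.sum_univ_three] at this
    rw [Matrix.mul_apply, Fin.sum_univ_five]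
    have h0 := congrFun this 0
    have h1 := congrFun this 1
    have h2 := congrFun this 2
    fin_cases j <;> simp [affineMatrix, T, A] at h0 h1 h2 ⊢ <;> linarith
  have hadj : ((A.map (Int.castRingHom ℝ)).updateCol 4 c).det =
      ∑ i, c i * (A.adjugate 4 i : ℤ) := by
    rw [← Matrix.cramer_apply, Matrix.cramer_eq_adjugate_mulVec, Matrix.mulVec, dotProduct]
    refine Finset.sum_congr rfl fun i _ => ?_
    have h1 := RingHom.map_adjugate (Int.castRingHom ℝ) A
    rw [RingHom.mapMatrix_apply, RingHom.mapMatrix_apply] at h1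
    rw [← h1, mul_comm]; simp
  rw [hmul, Matrix.det_mul, abs_mul, hT, ← hcov, hadj, mul_comm]

lemma inner_eq_coords (x y : EuclideanSpace ℝ (Fin 3)) :
    inner ℝ x y = x 0 * y 0 + x 1 * y 1 + x 2 * y 2 := by
  simp only [PiLp.inner_apply, Fin.sum_univ_three, RCLike.inner_apply, conj_trivial]
  ring

/-- The estimate of the covolume in terms of the edge lengths, together with the Gram matrix of
the edges in the case of equality. -/
lemma covolume_sq_le_and_gram (e : Fin 5 → EuclideanSpace ℝ (Fin 3)) (he : ∀ i, e i ≠ 0)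
    (k : Fin 5 → ℝ) {v : ℝ} (hdet : ∀ c, |(affineMatrix e c).det| = v * |∑ i, c i * k i|)
    (hk : 0 < ∑ i, k i ^ 2 * ‖e i‖) :
    27 * v ^ 2 * (∑ i, k i ^ 2 * ‖e i‖) ≤
        (∑ i, ‖e i‖) ^ 3 * ((∏ i, ‖e i‖) * ∑ i, ‖e i‖⁻¹) ∧
    (27 * v ^ 2 * (∑ i, k i ^ 2 * ‖e i‖) =
        (∑ i, ‖e i‖) ^ 3 * ((∏ i, ‖e i‖) * ∑ i, ‖e i‖⁻¹) →
      ∀ i j, ‖e i‖⁻¹ * (3 / (∑ i, ‖e i‖) * inner ℝ (e i) (e j) + (∑ i, ‖e i‖⁻¹)⁻¹ +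
        (∑ i, k i ^ 2 * ‖e i‖)⁻¹ * (k i * ‖e i‖) * (k j * ‖e j‖)) = if i = j then 1 else 0) := by
  have hl : ∀ i, 0 < ‖e i‖ := fun i => norm_pos_iff.mpr (he i)
  set K := ∑ i, k i ^ 2 * ‖e i‖ with hK
  set L := ∑ i, ‖e i‖ with hL
  set W := ∑ i, ‖e i‖⁻¹ with hW
  have hL0 : 0 < L := Finset.sum_pos (fun i _ => hl i) Finset.univ_nonempty
  have hW0 : 0 < W := Finset.sum_pos (fun i _ => inv_pos.mpr (hl i)) Finset.univ_nonempty
  set P := ∏ i, ‖e i‖ with hP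
  have hP0 : 0 < P := Finset.prod_pos fun i _ => hl i
  set M := affineMatrix e (fun i => k i * ‖e i‖) with hM
  have hMdet : M.det ^ 2 = v ^ 2 * K ^ 2 := by
    have hs : ∑ i, k i * ‖e i‖ * k i = K := Finset.sum_congr rfl fun i _ => by ring
    rw [← sq_abs, hdet, hs, mul_pow, sq_abs]
  have hnorm : ∀ i, e i 0 ^ 2 + e i 1 ^ 2 + e i 2 ^ 2 = ‖e i‖ ^ 2 := fun i => by
    rw [← real_inner_self_eq_norm_sq, inner_eq_coords]; ring
  -- The column weights are normalised so that the three coordinate columns together contribute 3,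
  -- and the other two columns 1 each.
  have htr : ∑ i, ∑ j, ‖e i‖⁻¹ * ![3 / L, 3 / L, 3 / L, W⁻¹, K⁻¹] j * M i j ^ 2 =
      Fintype.card (Fin 5) := by
    have : ∀ i, ∑ j, ‖e i‖⁻¹ * ![3 / L, 3 / L, 3 / L, W⁻¹, K⁻¹] j * M i j ^ 2 =
        3 / L * ‖e i‖ + W⁻¹ * ‖e i‖⁻¹ + K⁻¹ * (k i ^ 2 * ‖e i‖) := by
      intro i
      rw [Fin.sum_univ_five]
      simp [hM, affineMatrix]
      have h1 : ‖e i‖⁻¹ * ‖e i‖ ^ 2 = ‖e i‖ := by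
        have := (hl i).ne'
        field_simp
      calc _ = 3 / L * (‖e i‖⁻¹ * (e i 0 ^ 2 + e i 1 ^ 2 + e i 2 ^ 2)) + W⁻¹ * ‖e i‖⁻¹ +
            K⁻¹ * (k i ^ 2 * (‖e i‖⁻¹ * ‖e i‖ ^ 2)) := by ring
        _ = _ := by rw [hnorm, h1]
    simp only [this, Finset.sum_add_distrib, ← Finset.mul_sum]
    rw [← hL, ← hW, ← hK, inv_mul_cancel₀ hW0.ne', inv_mul_cancel₀ hk.ne',
      div_mul_cancel₀ _ hL0.ne']
    norm_num
  obtain ⟨hle, heq⟩ := M.weighted_hadamard (fun i => ‖e i‖⁻¹) ![3 / L, 3 / L, 3 / L, W⁻¹, K⁻¹]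
    (fun i => inv_pos.mpr (hl i)) (by
      have : 0 < 3 / L := by positivity
      intro i; fin_cases i <;> simp <;> positivity) htr
  have hval : M.det ^ 2 * (∏ i, ‖e i‖⁻¹) * (∏ i, ![3 / L, 3 / L, 3 / L, W⁻¹, K⁻¹] i) =
      (27 * v ^ 2 * K) / (L ^ 3 * (P * W)) := by
    rw [hMdet, Finset.prod_inv_distrib, ← hP, Fin.prod_univ_five]
    simp
    field_simp
    norm_num
  rw [hval] at hle heq
  have hpos : 0 < L ^ 3 * (P * W) := by positivity
  refine ⟨(div_le_one hpos).mp hle, fun h i j => ?_⟩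
  rw [← heq (by rw [h, div_self hpos.ne']) i j, Fin.sum_univ_five, inner_eq_coords]
  simp [hM, affineMatrix]
  left
  ring

/-! ### Recognising the square pyramid -/

/-- The vertices of a square pyramid from the Gram matrix of their position vectors. -/
lemma isSquarePyramid_of_inner {a b c d f : EuclideanSpace ℝ (Fin 3)} {t : ℝ} (ht : 0 < t)
    (haa : inner ℝ a a = 64 * t ^ 2) (hbb : inner ℝ b b = 64 * t ^ 2)
    (hcc : inner ℝ c c = 64 * t ^ 2) (hdd : inner ℝ d d = 64 * t ^ 2)
    (hff : inner ℝ f f = 169 * t ^ 2)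
    (hab : inner ℝ a b = -56 * t ^ 2) (hcd : inner ℝ c d = -56 * t ^ 2)
    (hac : inner ℝ a c = 4 * t ^ 2) (had : inner ℝ a d = 4 * t ^ 2)
    (hbc : inner ℝ b c = 4 * t ^ 2) (hbd : inner ℝ b d = 4 * t ^ 2)
    (haf : inner ℝ a f = -26 * t ^ 2) (hbf : inner ℝ b f = -26 * t ^ 2)
    (hcf : inner ℝ c f = -26 * t ^ 2) (hdf : inner ℝ d f = -26 * t ^ 2) :
    IsSquarePyramid {a, b, c, d, f} (15 * t) := by
  -- The Gram matrix gives a + b - c - d squared norm zero, so ab and cd are diagonals with a common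
  -- midpoint.
  have hsum : a + b = c + d := by
    rw [← sub_eq_zero, ← inner_self_eq_zero (𝕜 := ℝ)]
    rw [inner_eq_coords] at *
    simp only [PiLp.add_apply, PiLp.sub_apply]
    linarith
  have hd : d = a + b - c := by rw [hsum]; abel
  have hu : inner ℝ ((2⁻¹ : ℝ) • (a - b)) ((2⁻¹ : ℝ) • (a - b)) = 60 * t ^ 2 := by
    rw [inner_eq_coords] at *
    simp only [PiLp.smul_apply, PiLp.sub_apply, smul_eq_mul]
    linarith
  have hw : inner ℝ ((2⁻¹ : ℝ) • (c - d)) ((2⁻¹ : ℝ) • (c - d)) = 60 * t ^ 2 := by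
    rw [inner_eq_coords] at *
    simp only [PiLp.smul_apply, PiLp.sub_apply, smul_eq_mul]
    linarith
  have hz : inner ℝ (f - (2⁻¹ : ℝ) • (a + b)) (f - (2⁻¹ : ℝ) • (a + b)) = (15 * t) ^ 2 := by
    rw [inner_eq_coords] at *
    simp only [PiLp.smul_apply, PiLp.add_apply, PiLp.sub_apply, smul_eq_mul]
    linarith
  refine ⟨(2⁻¹ : ℝ) • (a + b), (2⁻¹ : ℝ) • (a - b), (2⁻¹ : ℝ) • (c - d), f - (2⁻¹ : ℝ) • (a + b),
    ?_, ?_, ?_, ?_, ?_, ?_, by positivity, ?_⟩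
  · intro h
    rw [h, inner_zero_left] at hu
    nlinarith [sq_pos_of_pos ht]
  · rw [real_inner_self_eq_norm_sq] at hu hw
    exact (sq_eq_sq₀ (norm_nonneg _) (norm_nonneg _)).mp (hu.trans hw.symm)
  · rw [inner_eq_coords] at *
    simp only [PiLp.smul_apply, PiLp.sub_apply, smul_eq_mul]
    linarith
  · rw [inner_eq_coords] at *
    simp only [PiLp.smul_apply, PiLp.add_apply, PiLp.sub_apply, smul_eq_mul]
    linarith
  · rw [inner_eq_coords] at *
    simp only [PiLp.smul_apply, PiLp.add_apply, PiLp.sub_apply, smul_eq_mul]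
    linarith
  · rw [real_inner_self_eq_norm_sq] at hz
    exact (sq_eq_sq₀ (norm_nonneg _) (by positivity)).mp hz
  · have e1 : (2⁻¹ : ℝ) • (a + b) + (2⁻¹ : ℝ) • (a - b) = a := by module
    have e2 : (2⁻¹ : ℝ) • (a + b) - (2⁻¹ : ℝ) • (a - b) = b := by module
    have e3 : (2⁻¹ : ℝ) • (a + b) + (2⁻¹ : ℝ) • (c - d) = c := by rw [hd]; module
    have e4 : (2⁻¹ : ℝ) • (a + b) - (2⁻¹ : ℝ) • (c - d) = d := by rw [hd]; module
    rw [e1, e2, e3, e4, add_sub_cancel]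

lemma IsSquarePyramid.image_const_add {S : Set (EuclideanSpace ℝ (Fin 3))} {h : ℝ}
    (hS : IsSquarePyramid S h) (p : EuclideanSpace ℝ (Fin 3)) :
    IsSquarePyramid ((p + ·) '' S) h := by
  obtain ⟨c, u, w, z, hu, huw, h1, h2, h3, h4, h5, rfl⟩ := hS
  refine ⟨p + c, u, w, z, hu, huw, h1, h2, h3, h4, h5, ?_⟩
  simp only [Set.image_insert_eq, Set.image_singleton, add_assoc, add_sub_assoc]

lemma range_eq_of_perm {α : Type*} (e : Fin 5 → α) (σ : Equiv.Perm (Fin 5)) :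
    Set.range e = {e (σ 0), e (σ 1), e (σ 2), e (σ 3), e (σ 4)} := by
  rw [← σ.surjective.range_comp e]
  ext x
  simp only [Set.mem_range, Function.comp_apply, Set.mem_insert_iff, Set.mem_singleton_iff,
    Fin.exists_fin_succ, Fin.exists_fin_zero]
  simp [eq_comm]

/-- Five vectors with the Gram matrix of the extremal configuration, where the signs `k` are
those of an affine dependency, form a square pyramid. -/
lemma isSquarePyramid_range (e : Fin 5 → EuclideanSpace ℝ (Fin 3)) (k : Fin 5 → ℤ)
    (σ : Equiv.Perm (Fin 5)) {t : ℝ} (ht : 0 < t) (h4 : k (σ 4) = 0)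
    (hk : ∀ i, i ≠ 4 → k (σ i) = 1 ∨ k (σ i) = -1) (hsum : ∑ i, k (σ i) = 0)
    (hnorm : ∀ i, i ≠ 4 → ‖e (σ i)‖ = 8 * t) (hnorm4 : ‖e (σ 4)‖ = 13 * t)
    (hinner : ∀ i j, i ≠ j →
      inner ℝ (e i) (e j) = -26 * t ^ 2 - 15 / 32 * (k i * ‖e i‖) * (k j * ‖e j‖)) :
    IsSquarePyramid (Set.range e) (15 * t) := by
  have hself : ∀ i, i ≠ 4 → inner ℝ (e (σ i)) (e (σ i)) = 64 * t ^ 2 := fun i hi => by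
    rw [real_inner_self_eq_norm_sq, hnorm i hi]; ring
  have hself4 : inner ℝ (e (σ 4)) (e (σ 4)) = 169 * t ^ 2 := by
    rw [real_inner_self_eq_norm_sq, hnorm4]; ring
  have hi4 : ∀ i, i ≠ 4 → inner ℝ (e (σ i)) (e (σ 4)) = -26 * t ^ 2 := fun i hi => by
    rw [hinner _ _ (σ.injective.ne hi), h4]; simp
  have hij : ∀ i j, i ≠ 4 → j ≠ 4 → i ≠ j → inner ℝ (e (σ i)) (e (σ j)) =
      -26 * t ^ 2 - 30 * t ^ 2 * (k (σ i) * k (σ j) : ℤ) := fun i j hi hj h => by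
    rw [hinner _ _ (σ.injective.ne h), hnorm i hi, hnorm j hj]; push_cast; ring
  have heq : ∀ i j, i ≠ 4 → j ≠ 4 → i ≠ j → k (σ i) * k (σ j) = 1 →
      inner ℝ (e (σ i)) (e (σ j)) = -56 * t ^ 2 := fun i j hi hj h hh => by
    rw [hij i j hi hj h, hh]; push_cast; ring
  have hne : ∀ i j, i ≠ 4 → j ≠ 4 → i ≠ j → k (σ i) * k (σ j) = -1 →
      inner ℝ (e (σ i)) (e (σ j)) = 4 * t ^ 2 := fun i j hi hj h hh => by
    rw [hij i j hi hj h, hh]; push_cast; ring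
  have main : ∀ i j m n : Fin 5, i ≠ 4 → j ≠ 4 → m ≠ 4 → n ≠ 4 → i ≠ j → i ≠ m → i ≠ n → j ≠ m →
      j ≠ n → m ≠ n → k (σ i) * k (σ j) = 1 → k (σ m) * k (σ n) = 1 → k (σ i) * k (σ m) = -1 →
      IsSquarePyramid {e (σ i), e (σ j), e (σ m), e (σ n), e (σ 4)} (15 * t) := by
    intro i j m n hi hj hm hn hij' him hin hjm hjn hmn h1 h2 h3
    have hsq : ∀ i, i ≠ 4 → k (σ i) * k (σ i) = 1 := fun i hi => by
      rcases hk i hi with h | h <;> rw [h] <;> rfl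
    have h5 : k (σ i) * k (σ n) = -1 := by
      linear_combination -(k (σ i) * k (σ n)) * hsq m hm + k (σ m) * k (σ n) * h3 - h2
    have h6 : k (σ j) * k (σ m) = -1 := by
      linear_combination -(k (σ j) * k (σ m)) * hsq i hi + k (σ i) * k (σ j) * h3 - h1
    have h7 : k (σ j) * k (σ n) = -1 := by
      linear_combination -(k (σ j) * k (σ n)) * hsq m hm + k (σ m) * k (σ n) * h6 - h2
    exact isSquarePyramid_of_inner ht (hself i hi) (hself j hj) (hself m hm) (hself n hn) hself4
      (heq i j hi hj hij' h1) (heq m n hm hn hmn h2) (hne i m hi hm him h3) (hne i n hi hn hin h5)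
      (hne j m hj hm hjm h6) (hne j n hj hn hjn h7) (hi4 i hi) (hi4 j hj) (hi4 m hm) (hi4 n hn)
  rw [Fin.sum_univ_five, h4] at hsum
  rw [range_eq_of_perm e σ]
  have k0 := hk 0 (by decide)
  have k1 := hk 1 (by decide)
  have k2 := hk 2 (by decide)
  have k3 := hk 3 (by decide)
  -- Two signs are positive and two negative, and equal signs mark opposite corners; the cases
  -- differ in the corner opposite to `σ 0`.
  have hcases : (k (σ 0) * k (σ 1) = 1 ∧ k (σ 2) * k (σ 3) = 1 ∧ k (σ 0) * k (σ 2) = -1) ∨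
      (k (σ 0) * k (σ 2) = 1 ∧ k (σ 1) * k (σ 3) = 1 ∧ k (σ 0) * k (σ 1) = -1) ∨
      (k (σ 0) * k (σ 3) = 1 ∧ k (σ 1) * k (σ 2) = 1 ∧ k (σ 0) * k (σ 1) = -1) := by
    rcases k0 with a | a <;> rcases k1 with b | b <;> rcases k2 with c | c <;>
      rcases k3 with d | d <;> rw [a, b, c, d] at hsum ⊢ <;> revert hsum <;> decide
  rcases hcases with ⟨h1, h2, h3⟩ | ⟨h1, h2, h3⟩ | ⟨h1, h2, h3⟩
  · exact main 0 1 2 3 (by decide) (by decide) (by decide) (by decide) (by decide) (by decide)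
      (by decide) (by decide) (by decide) (by decide) h1 h2 h3
  · convert main 0 2 1 3 (by decide) (by decide) (by decide) (by decide) (by decide) (by decide)
      (by decide) (by decide) (by decide) (by decide) h1 h2 h3 using 1
    rw [Set.insert_comm (e (σ 1))]
  · convert main 0 3 1 2 (by decide) (by decide) (by decide) (by decide) (by decide) (by decide)
      (by decide) (by decide) (by decide) (by decide) h1 h2 h3 using 1
    rw [Set.insert_comm (e (σ 2)), Set.insert_comm (e (σ 1)) (e (σ 3))]

/-! ### The sharp bound for five vectors -/

lemma prod_mul_sum_inv_eq_esymmFour {l : Fin 5 → ℝ} (hl : ∀ i, 0 < l i)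
    (σ : Equiv.Perm (Fin 5)) :
    (∏ i, l i) * ∑ i, (l i)⁻¹ = esymmFour (l (σ 0)) (l (σ 1)) (l (σ 2)) (l (σ 3)) (l (σ 4)) := by
  rw [← Equiv.prod_comp σ, ← Equiv.sum_comp σ, Fin.prod_univ_five, Fin.sum_univ_five, esymmFour]
  have := fun i => (hl (σ i)).ne'
  field_simp [this 0, this 1, this 2, this 3, this 4]
  ring

/-- Since 405² = 27 · 6075 and 8² = 64, chaining the two estimates and cancelling K leaves a
comparison of squares. Equality at the end forces equality in the estimate of E. -/
lemma cube_bound_of_sq_bound {v L K E : ℝ} (hv : 0 < v) (hL : 0 < L) (hK : 0 < K)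
    (hle : 27 * v ^ 2 * K ≤ L ^ 3 * E) :
    (6075 * E ≤ 64 * L ^ 3 * K → 405 * v ≤ 8 * L ^ 3) ∧
    (405 * v = 8 * L ^ 3 → 64 * L ^ 3 * K ≤ 6075 * E) := by
  have hL3 : 0 < L ^ 3 := by positivity
  constructor <;> intro h
  · have h1 : (405 * v) ^ 2 * K ≤ (8 * L ^ 3) ^ 2 * K := by
      have := mul_le_mul_of_nonneg_left h hL3.le
      linarith
    exact (sq_le_sq₀ (by positivity) (by positivity)).mp (le_of_mul_le_mul_right h1 hK)
  · have h1 : (405 * v) ^ 2 * K = (8 * L ^ 3) ^ 2 * K := by rw [h]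
    refine le_of_mul_le_mul_left (a := L ^ 3) ?_ hL3
    linarith

/-- An integral affine dependency between distinct points involves at least three of them. -/
lemma exists_ne_of_affine_dependency {e : Fin 5 → EuclideanSpace ℝ (Fin 3)}
    (hinj : Function.Injective e) {k : Fin 5 → ℤ} (hk0 : k ≠ 0) (hksum : ∑ i, k i = 0)
    (hkvec : ∑ i, (k i : ℝ) • e i = 0) (i j : Fin 5) : ∃ x, x ≠ i ∧ x ≠ j ∧ k x ≠ 0 := by
  wlog hij : i ≠ j generalizing i j
  · obtain ⟨j', hj'⟩ := exists_ne i
    obtain ⟨x, h1, h2, h3⟩ := this i j' hj'.symm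
    push Not at hij
    exact ⟨x, h1, hij ▸ h1, h3⟩
  by_contra! h
  have hsupp : ∀ x, x ∉ ({i, j} : Finset (Fin 5)) → k x = 0 := by
    intro x hx
    simp only [Finset.mem_insert, Finset.mem_singleton, not_or] at hx
    exact h x hx.1 hx.2
  have h1 : k i + k j = 0 := by
    rw [← hksum, ← Finset.sum_subset (Finset.subset_univ {i, j}) fun x _ hx => hsupp x hx,
      Finset.sum_pair hij]
  -- A dependency between two points would be a multiple of their difference.
  have h2 : (k i : ℝ) • e i + (k j : ℝ) • e j = 0 := by
    rw [← hkvec, ← Finset.sum_subset (Finset.subset_univ {i, j}) fun x _ hx => by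
      simp [hsupp x hx], Finset.sum_pair hij]
  have h3 : k j = -k i := by omega
  rw [h3, Int.cast_neg, neg_smul, ← sub_eq_add_neg, ← smul_sub, smul_eq_zero] at h2
  rcases h2 with h2 | h2
  · have hki : k i = 0 := by exact_mod_cast h2
    apply hk0
    funext x
    by_cases hx : x ∈ ({i, j} : Finset (Fin 5))
    · simp only [Finset.mem_insert, Finset.mem_singleton] at hx
      rcases hx with rfl | rfl
      · exact hki
      · rw [h3, hki]; rfl
    · exact hsupp x hx
  · exact hij (hinj (sub_eq_zero.mp h2))

/-- Five distinct nonzero vectors in `3`-space whose differences lie in a lattice and span the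
space: the sharp bound for the covolume, and the configuration in the case of equality. -/
lemma covolume_le_and_isSquarePyramid (Λ : Submodule ℤ (EuclideanSpace ℝ (Fin 3)))
    [DiscreteTopology Λ] [IsZLattice ℝ Λ] (e : Fin 5 → EuclideanSpace ℝ (Fin 3))
    (he0 : ∀ i, e i ≠ 0) (hinj : Function.Injective e) (hmem : ∀ i, e i - e 0 ∈ Λ)
    (hspan : ∀ α : EuclideanSpace ℝ (Fin 3), (∀ i, inner ℝ α (e i) = inner ℝ α (e 0)) → α = 0) :
    405 * ZLattice.covolume Λ ≤ 8 * (∑ i, ‖e i‖) ^ 3 ∧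
    (405 * ZLattice.covolume Λ = 8 * (∑ i, ‖e i‖) ^ 3 →
      IsSquarePyramid (Set.range e) ((∑ i, ‖e i‖) / 3)) := by
  obtain ⟨k, hdet⟩ := exists_int_abs_det_affineMatrix Λ e hmem
  set v := ZLattice.covolume Λ with hv
  have hv0 : 0 < v := ZLattice.covolume_pos Λ
  have hzero : ∀ c, (affineMatrix e c).det = 0 → ∑ i, c i * (k i : ℝ) = 0 := by
    intro c hc
    have := hdet c
    rw [hc, abs_zero, eq_comm, mul_eq_zero] at this
    exact abs_eq_zero.mp (this.resolve_left hv0.ne')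
  -- Repeating an earlier column as the last one kills the determinant: the column of ones gives the
  -- sum, the coordinate columns the vector relation.
  have hksum : ∑ i, (k i : ℝ) = 0 := by
    have := hzero (fun _ => 1) (Matrix.det_zero_of_column_eq (i := 3) (j := 4) (by decide)
      fun i => by simp [affineMatrix])
    simpa using this
  have hkcoord : ∀ j, ∑ i, e i j * (k i : ℝ) = 0 := by
    intro j
    refine hzero (fun i => e i j)
      (Matrix.det_zero_of_column_eq (i := Fin.castLE (by decide) j) (j := 4) ?_ ?_)
    · fin_cases j <;> decide
    · intro i; fin_cases j <;> rfl
  have hkvec : ∑ i, (k i : ℝ) • e i = 0 := by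
    ext j
    simpa [mul_comm] using hkcoord j
  have hk0 : k ≠ 0 := by
    obtain ⟨c, hc⟩ := exists_det_affineMatrix_ne_zero e hspan
    rintro rfl
    have := hdet c
    simp only [Pi.zero_apply, Int.cast_zero, mul_zero, Finset.sum_const_zero, abs_zero] at this
    exact hc (abs_eq_zero.mp this)
  have hksumZ : ∑ i, k i = 0 := by exact_mod_cast hksum
  have hthree := exists_ne_of_affine_dependency hinj hk0 hksumZ hkvec
  obtain ⟨σ, hσ⟩ := exists_perm_of_sum_eq_zero k hksumZ hthree
  have hl : ∀ i, 0 < ‖e i‖ := fun i => norm_pos_iff.mpr (he0 i)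
  have hone : ∀ {m : ℤ}, m ≠ 0 → (1 : ℝ) ≤ (m : ℝ) ^ 2 := by
    intro m hm
    exact_mod_cast Int.one_le_abs (pow_ne_zero 2 hm) |>.trans_eq (abs_of_nonneg (sq_nonneg m))
  have hKσ := (Equiv.sum_comp σ fun i => (k i : ℝ) ^ 2 * ‖e i‖).symm
  have hLσ : ∑ i, ‖e i‖ = ‖e (σ 0)‖ + ‖e (σ 1)‖ + ‖e (σ 2)‖ + ‖e (σ 3)‖ + ‖e (σ 4)‖ := by
    rw [← Equiv.sum_comp σ, Fin.sum_univ_five]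
  rw [Fin.sum_univ_five fun i => (k (σ i) : ℝ) ^ 2 * ‖e (σ i)‖] at hKσ
  have l0 := hl (σ 0)
  have l1 := hl (σ 1)
  have l2 := hl (σ 2)
  have l3 := hl (σ 3)
  have l4 := hl (σ 4)
  have hk4nn : 0 ≤ (k (σ 4) : ℝ) ^ 2 * ‖e (σ 4)‖ := by positivity
  have hk3nn : 0 ≤ (k (σ 3) : ℝ) ^ 2 * ‖e (σ 3)‖ := by positivity
  have hmulone : ∀ i, k (σ i) ≠ 0 → ‖e (σ i)‖ ≤ (k (σ i) : ℝ) ^ 2 * ‖e (σ i)‖ := fun i hi =>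
    le_mul_of_one_le_left (hl _).le (hone hi)
  have hK0 : 0 < ∑ i, (k i : ℝ) ^ 2 * ‖e i‖ := by
    obtain ⟨x, -, -, hx⟩ := hthree 0 0
    refine Finset.sum_pos' (fun i _ => by positivity) ⟨x, Finset.mem_univ x, ?_⟩
    have := hl x
    have : (k x : ℝ) ≠ 0 := by exact_mod_cast hx
    positivity
  obtain ⟨hle, hgram⟩ := covolume_sq_le_and_gram e he0 (fun i => (k i : ℝ)) hdet hK0
  rw [prod_mul_sum_inv_eq_esymmFour hl σ] at hle hgram
  set L := ∑ i, ‖e i‖ with hL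
  set K := ∑ i, (k i : ℝ) ^ 2 * ‖e i‖ with hK
  have hL0 : 0 < L := by rw [hLσ]; positivity
  set E := esymmFour ‖e (σ 0)‖ ‖e (σ 1)‖ ‖e (σ 2)‖ ‖e (σ 3)‖ ‖e (σ 4)‖ with hE
  clear_value v L K E
  obtain ⟨hfin, hfineq⟩ := cube_bound_of_sq_bound hv0 hL0 hK0 hle
  rcases hσ with ⟨h0, h1, h2, h3⟩ | ⟨h0, h1, h2⟩
  · obtain ⟨hE1, hE2⟩ := esymmFour_le_of_four l0 l1 l2 l3 l4
    rw [← hE, ← hLσ] at hE1 hE2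
    have m0 := hmulone 0 h0
    have m1 := hmulone 1 h1
    have m2 := hmulone 2 h2
    have m3 := hmulone 3 h3
    have hS : ‖e (σ 0)‖ + ‖e (σ 1)‖ + ‖e (σ 2)‖ + ‖e (σ 3)‖ ≤ K := by linarith
    have hEK : 6075 * E ≤ 64 * L ^ 3 * K := hE1.trans (by gcongr)
    refine ⟨hfin hEK, fun heq => ?_⟩
    have hEKeq : 6075 * E = 64 * L ^ 3 * K := le_antisymm hEK (hfineq heq)
    have hSK : ‖e (σ 0)‖ + ‖e (σ 1)‖ + ‖e (σ 2)‖ + ‖e (σ 3)‖ = K := by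
      refine le_antisymm hS ?_
      rw [hEKeq] at hE1
      exact le_of_mul_le_mul_left hE1 (by positivity)
    obtain ⟨q1, q2, q3, q4⟩ := hE2 (by rw [hSK, hEKeq])
    -- 45 = 4 · 8 + 13, from the extremal ratio of lengths.
    set t := L / 45 with ht
    have hLt : L = 45 * t := by rw [ht]; ring
    have ht0 : 0 < t := by positivity
    have n0 : ‖e (σ 0)‖ = 8 * t := by linarith
    have n1 : ‖e (σ 1)‖ = 8 * t := by linarith
    have n2 : ‖e (σ 2)‖ = 8 * t := by linarith
    have n3 : ‖e (σ 3)‖ = 8 * t := by linarith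
    have n4 : ‖e (σ 4)‖ = 13 * t := by linarith
    have hKt : K = 32 * t := by linarith
    have hW : (∑ i, ‖e i‖⁻¹)⁻¹ = 26 / 15 * t := by
      rw [← Equiv.sum_comp σ, Fin.sum_univ_five, n0, n1, n2, n3, n4]
      field_simp
      norm_num
    have hg := hgram (by
      have h5 : (405 * v) ^ 2 * K = (8 * L ^ 3) ^ 2 * K := by rw [heq]
      have h6 : L ^ 3 * (6075 * E) = L ^ 3 * (64 * L ^ 3 * K) := by rw [hEKeq]
      linarith)
    have hunit : ∀ i, k (σ i) ≠ 0 → (k (σ i) : ℝ) ^ 2 * ‖e (σ i)‖ = ‖e (σ i)‖ →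
        k (σ i) = 1 ∨ k (σ i) = -1 := by
      intro i _ hi
      have := mul_right_cancel₀ (hl (σ i)).ne' (hi.trans (one_mul _).symm)
      exact sq_eq_one_iff.mp (by exact_mod_cast this)
    -- K is already exhausted by the four other lengths.
    have hk4 : k (σ 4) = 0 := by
      have : (k (σ 4) : ℝ) ^ 2 * ‖e (σ 4)‖ = 0 := by linarith
      have := (mul_eq_zero.mp this).resolve_right l4.ne'
      exact_mod_cast pow_eq_zero_iff (two_ne_zero) |>.mp this
    have hfour : ∀ P : Fin 5 → Prop, P 0 → P 1 → P 2 → P 3 → ∀ i, i ≠ 4 → P i := by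
      intro P p0 p1 p2 p3 i hi
      fin_cases i <;> first | assumption | exact absurd rfl hi
    have hpyr := isSquarePyramid_range e k σ ht0 hk4
      (hfour _ (hunit 0 h0 (by linarith)) (hunit 1 h1 (by linarith)) (hunit 2 h2 (by linarith))
        (hunit 3 h3 (by linarith)))
      ((Equiv.sum_comp σ k).trans hksumZ) (hfour _ n0 n1 n2 n3) n4 (by
        intro i j hij
        have := hg i j
        rw [if_neg hij, hW, hKt, hLt, mul_eq_zero] at this
        have := this.resolve_left (inv_pos.mpr (hl i)).ne'
        field_simp at this
        linarith)
    rw [hLt]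
    convert hpyr using 1
    ring
  · have hk0sq : (4 : ℝ) ≤ (k (σ 0) : ℝ) ^ 2 := by
      have : (2 : ℤ) ^ 2 ≤ k (σ 0) ^ 2 := by
        rw [← sq_abs (k (σ 0))]; gcongr
      exact_mod_cast this
    have m0 : 4 * ‖e (σ 0)‖ ≤ (k (σ 0) : ℝ) ^ 2 * ‖e (σ 0)‖ := by gcongr
    have m1 := hmulone 1 h1
    have m2 := hmulone 2 h2
    have hS : 4 * ‖e (σ 0)‖ + ‖e (σ 1)‖ + ‖e (σ 2)‖ ≤ K := by linarith
    have hlt := esymmFour_lt_of_three l0 l1 l2 l3 l4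
    rw [← hE, ← hLσ] at hlt
    have hEK : 6075 * E < 64 * L ^ 3 * K := hlt.trans_le (by gcongr)
    exact ⟨hfin hEK.le, fun heq => absurd (hfineq heq) (not_le.mpr hEK)⟩

/-! ### From the network to the edge vectors at a vertex -/

namespace PeriodicNetwork

variable {n d : ℕ} {V : Type*} (N : PeriodicNetwork n d V)

lemma toQuotientVertex_eq_iff {u v : V} :
    N.toQuotientVertex u = N.toQuotientVertex v ↔ ∃ g : N.Λ, g +ᵥ v = u :=
  ⟨fun h => Quotient.exact h, fun ⟨g, hg⟩ => by rw [← hg, toQuotientVertex_vadd]⟩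

lemma quotientGraph_isLink {u v : V} (h : N.graph.Adj u v) :
    N.quotientGraph.IsLink (N.toQuotientEdge ⟨s(u, v), h⟩) (N.toQuotientVertex u)
      (N.toQuotientVertex v) :=
  ⟨u, v, h, rfl, rfl, rfl⟩

lemma quotientGraph_edgeSet : N.quotientGraph.edgeSet = Set.univ := by
  refine Set.eq_univ_of_forall fun e => ?_
  induction e using Quotient.inductionOn with
  | _ e =>
    obtain ⟨e, he⟩ := e
    induction e using Sym2.ind with
    | _ u v => exact (N.quotientGraph_isLink (show N.graph.Adj u v from he)).edge_mem

lemma edgeLength_toQuotientEdge {u v : V} (h : N.graph.Adj u v) :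
    N.edgeLength (N.toQuotientEdge ⟨s(u, v), h⟩) = dist (N.pos u) (N.pos v) :=
  rfl

/-- Embeddedness of the star enters here; it makes the five edge vectors distinct. -/
lemma pos_injOn_neighborSet (v : V) : Set.InjOn N.pos (N.graph.neighborSet v) := by
  intro u hu w hw h
  by_contra hne
  have := N.star_embedded v u w hu hw hne
  rw [← h, Set.inter_self] at this
  exact N.pos_ne v u hu (this.subset (right_mem_segment ℝ _ _)).symm

lemma adj_of_vadd {g : N.Λ} {u v : V} (h : N.graph.Adj (g +ᵥ u) v) :
    N.graph.Adj u (-g +ᵥ v) := by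
  simpa using N.adj_vadd (-g) _ _ h

/-- A network with quotient graph a dipole: both ends of every edge have different classes, and
there are only two classes. -/
lemma classes_of_iso_dipole {k : ℕ} (hN : MultigraphIso N.quotientGraph (dipoleGraph k)) :
    (∀ u v, N.graph.Adj u v → N.toQuotientVertex u ≠ N.toQuotientVertex v) ∧
    (∀ u v w, N.toQuotientVertex u ≠ N.toQuotientVertex v →
      N.toQuotientVertex w ≠ N.toQuotientVertex v →
      N.toQuotientVertex w = N.toQuotientVertex u) ∧
    ∀ (v : V) (e : N.QuotientEdge), N.quotientGraph.Inc e (N.toQuotientVertex v) := by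
  obtain ⟨f, g, hfg⟩ := hN
  have hval : ∀ a b c : Fin 2, a ≠ b → c ≠ b → c = a := by decide
  refine ⟨fun u v h huv => ?_, fun u v w huv hwv => ?_, fun v e => ?_⟩
  · have h1 := (hfg ⟨_, (N.quotientGraph_isLink h).edge_mem⟩ ⟨N.toQuotientVertex u, trivial⟩
      ⟨N.toQuotientVertex v, trivial⟩).mp (N.quotientGraph_isLink h)
    have h2 : f ⟨N.toQuotientVertex u, trivial⟩ = f ⟨N.toQuotientVertex v, trivial⟩ := by
      simp only [huv]
    rw [h2] at h1
    rcases h1.2 with ⟨a, b⟩ | ⟨a, b⟩ <;> rw [a] at b <;> exact absurd b (by decide)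
  · have key : ∀ x y : V, N.toQuotientVertex x ≠ N.toQuotientVertex y →
        (f ⟨N.toQuotientVertex x, trivial⟩ : Fin 2) ≠ f ⟨N.toQuotientVertex y, trivial⟩ := by
      intro x y hxy h
      exact hxy (congrArg Subtype.val (f.injective (Subtype.ext h)))
    have h3 := hval _ _ _ (key u v huv) (key w v hwv)
    exact congrArg Subtype.val (f.injective (Subtype.ext h3))
  · have he : e ∈ N.quotientGraph.edgeSet := by rw [quotientGraph_edgeSet]; trivial
    set x := f ⟨N.toQuotientVertex v, trivial⟩ with hx
    obtain ⟨y, hy⟩ : ∃ y : (dipoleGraph k).vertexSet, (dipoleGraph k).IsLink (g ⟨e, he⟩) x y := by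
      rcases x.2 with h | h
      · exact ⟨⟨1, Or.inr rfl⟩, Set.mem_univ _, Or.inl ⟨h, rfl⟩⟩
      · exact ⟨⟨0, Or.inl rfl⟩, Set.mem_univ _, Or.inr ⟨h, rfl⟩⟩
    refine ⟨f.symm y, (hfg ⟨e, he⟩ ⟨N.toQuotientVertex v, trivial⟩ (f.symm y)).mpr ?_⟩
    rw [Equiv.apply_symm_apply]
    exact hy

/-- If the quotient graph is a dipole, the edges at a vertex represent every edge of the quotient
exactly once. -/
lemma bijective_neighborSet_to_quotientEdge {k : ℕ}
    (hN : MultigraphIso N.quotientGraph (dipoleGraph k)) (v : V) :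
    Function.Bijective fun u : N.graph.neighborSet v =>
      N.toQuotientEdge ⟨s(v, (u : V)), u.2⟩ := by
  obtain ⟨hne, -, hinc⟩ := N.classes_of_iso_dipole hN
  constructor
  · rintro ⟨u, hu⟩ ⟨w, hw⟩ h
    obtain ⟨g, hg⟩ := Quotient.exact h
    simp only [Sym2.map_mk, Sym2.eq_iff] at hg
    -- A translation identifying two edges at v either fixes v, hence is zero, or moves v to a
    -- neighbour, which lies in the other class.
    rcases hg with ⟨h1, h2⟩ | ⟨h1, -⟩
    · have h3 := N.pos_vadd g v
      rw [h1, right_eq_add] at h3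
      have h4 : g = 0 := Subtype.ext h3
      rw [h4, zero_vadd] at h2
      exact Subtype.ext h2
    · refine absurd ?_ (hne v w hw)
      rw [← h1, toQuotientVertex_vadd]
  · intro e
    obtain ⟨y, u, w, h, rfl, hu, -⟩ := hinc v e
    obtain ⟨g, rfl⟩ := N.toQuotientVertex_eq_iff.mp hu
    refine ⟨⟨-g +ᵥ w, N.adj_of_vadd h⟩, Quotient.sound ⟨g, ?_⟩⟩
    simp

lemma exists_neighbours_of_iso_dipole {k : ℕ}
    (hN : MultigraphIso N.quotientGraph (dipoleGraph k)) (v : V) :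
    ∃ m : Fin k → V, Function.Injective m ∧ Set.range m = N.graph.neighborSet v ∧
      N.length = ∑ i, ‖N.pos (m i) - N.pos v‖ := by
  let φ := Equiv.ofBijective _ (N.bijective_neighborSet_to_quotientEdge hN v)
  obtain ⟨f, g, -⟩ := id hN
  let ψ : Fin k ≃ N.QuotientEdge :=
    (Equiv.Set.univ (Fin k)).symm.trans
      (g.symm.trans ((Equiv.setCongr N.quotientGraph_edgeSet).trans (Equiv.Set.univ _)))
  let χ : Fin k ≃ N.graph.neighborSet v := ψ.trans φ.symm
  refine ⟨fun i => χ i, Subtype.val_injective.comp χ.injective, ?_, ?_⟩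
  · rw [← Function.comp_def, χ.surjective.range_comp]
    exact Subtype.range_coe
  · rw [length, ← finsum_comp_equiv (χ.trans φ), finsum_eq_sum_of_fintype]
    refine Finset.sum_congr rfl fun i _ => ?_
    rw [← dist_eq_norm, dist_comm]
    exact N.edgeLength_toQuotientEdge (χ i).2

/-- If the quotient graph is a dipole, the differences of the edge vectors at a vertex span. -/
lemma eq_zero_of_inner_const {k : ℕ} (hN : MultigraphIso N.quotientGraph (dipoleGraph k)) (v : V)
    (α : EuclideanSpace ℝ (Fin n)) (c : ℝ)
    (hα : ∀ u, N.graph.Adj v u → inner ℝ α (N.pos u - N.pos v) = c) : α = 0 := by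
  obtain ⟨hne, htwo, -⟩ := N.classes_of_iso_dipole hN
  have hedge : ∀ x y, N.toQuotientVertex x = N.toQuotientVertex v → N.graph.Adj x y →
      inner ℝ α (N.pos y - N.pos x) = c := by
    intro x y hx hxy
    obtain ⟨g, rfl⟩ := N.toQuotientVertex_eq_iff.mp hx
    rw [← hα _ (N.adj_of_vadd hxy), N.pos_vadd, N.pos_vadd]
    congr 1
    push_cast
    abel
  -- Along a walk the height in direction α alternates between 0 and c according to the class.
  -- Lattice translates of v thus have height 0, so α is orthogonal to Λ.
  have hreach : ∀ x, (N.toQuotientVertex x = N.toQuotientVertex v →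
      inner ℝ α (N.pos x - N.pos v) = 0) ∧ (N.toQuotientVertex x ≠ N.toQuotientVertex v →
      inner ℝ α (N.pos x - N.pos v) = c) := by
    intro x
    obtain ⟨p⟩ := N.connected.preconnected x v
    induction p with
    | nil => exact ⟨fun _ => by simp, fun h => absurd rfl h⟩
    | @cons x y v hxy p ih =>
      obtain ⟨ih1, ih2⟩ := ih hα hedge
      have hsplit : N.pos x - N.pos v = (N.pos y - N.pos v) - (N.pos y - N.pos x) := by abel
      refine ⟨fun hx => ?_, fun hx => ?_⟩
      · rw [hsplit, inner_sub_right, hedge x y hx hxy, ih2 fun hy => hne x y hxy (hx.trans hy.symm),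
          sub_self]
      · have hy : N.toQuotientVertex y = N.toQuotientVertex v := by
          by_contra hy
          exact hne x y hxy (htwo y v x hy hx)
        have hsplit' : N.pos x - N.pos v = (N.pos y - N.pos v) + (N.pos x - N.pos y) := by abel
        rw [hsplit', inner_add_right, hedge y x hy hxy.symm, ih1 hy, zero_add]
  have hlat : ∀ g ∈ (N.Λ : Set (EuclideanSpace ℝ (Fin n))), inner ℝ α g = 0 := by
    intro g hg
    have := (hreach ((⟨g, hg⟩ : N.Λ) +ᵥ v)).1 (N.toQuotientVertex_vadd _ _)
    rwa [N.pos_vadd, add_sub_cancel_right] at this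
  have htop : Submodule.span ℝ (N.Λ : Set (EuclideanSpace ℝ (Fin n))) ≤ (ℝ ∙ α)ᗮ :=
    Submodule.span_le.mpr fun g hg => Submodule.mem_orthogonal_singleton_iff_inner_right.mpr
      (hlat g hg)
  rw [IsZLattice.span_top] at htop
  exact inner_self_eq_zero.mp (Submodule.mem_orthogonal_singleton_iff_inner_right.mp
    (htop (Submodule.mem_top (x := α))))

end PeriodicNetwork

/-! ### Conclusion -/

theorem theorem7p2 {d : ℕ} {V : Type*} (N : PeriodicNetwork 3 d V)
    (hN : MultigraphIso N.quotientGraph (dipoleGraph 5)) :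
    405 / 8 ≤ N.length ^ 3 / N.spannedVolume ∧
      (N.length ^ 3 / N.spannedVolume = 405 / 8 →
        ∀ v : V, IsSquarePyramid (N.neighbourPositions v) (N.length / 3)) := by
  have hvol : 0 < N.spannedVolume := ZLattice.covolume_pos N.Λ MeasureTheory.volume
  have key : ∀ v : V, 405 * N.spannedVolume ≤ 8 * N.length ^ 3 ∧
      (405 * N.spannedVolume = 8 * N.length ^ 3 →
        IsSquarePyramid (N.neighbourPositions v) (N.length / 3)) := by
    intro v
    obtain ⟨hne, htwo, -⟩ := N.classes_of_iso_dipole hN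
    obtain ⟨m, hm, hrange, hlen⟩ := N.exists_neighbours_of_iso_dipole hN v
    have hadj : ∀ i, N.graph.Adj v (m i) := fun i => hrange.subset ⟨i, rfl⟩
    obtain ⟨h1, h2⟩ := covolume_le_and_isSquarePyramid N.Λ (fun i => N.pos (m i) - N.pos v)
      (fun i => sub_ne_zero.mpr (N.pos_ne _ _ (hadj i)).symm)
      (fun i j hij => hm (N.pos_injOn_neighborSet v (hadj i) (hadj j) (sub_left_injective hij)))
      (fun i => by
        -- All neighbours of v lie in the class other than that of v, so they differ by lattice
        -- vectors.
        obtain ⟨g, hg⟩ := N.toQuotientVertex_eq_iff.mp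
          (htwo (m 0) v (m i) (hne _ _ (hadj 0)).symm (hne _ _ (hadj i)).symm)
        rw [← hg, N.pos_vadd]
        convert g.2 using 1
        abel)
      (fun α hα => N.eq_zero_of_inner_const hN v α _ fun u hu => by
        obtain ⟨i, rfl⟩ := hrange.superset hu
        exact hα i)
    rw [← hlen] at h1 h2
    refine ⟨h1, fun h => ?_⟩
    convert (h2 h).image_const_add (N.pos v) using 1
    rw [PeriodicNetwork.neighbourPositions, ← hrange, ← Set.range_comp, ← Set.range_comp]
    congr 1
    funext i
    simp
  obtain ⟨v₀⟩ := N.connected.nonempty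
  refine ⟨?_, fun h v => (key v).2 ?_⟩
  · rw [div_le_div_iff₀ (by norm_num) hvol]
    linarith [(key v₀).1]
  · rw [div_eq_div_iff hvol.ne' (by norm_num)] at h
    linarith
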